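/- Let $\mathbb{F}_q$ be a finite field with $q$ elements, let $n \ge 0$ be an integer, and let $GL(n,q)$ be the group of invertible $n \times n$ matrices over $\mathbb{F}_q$. Then for every $g \in GL(n,q)$ the centralizer $C(g) = \{h \in GL(n,q) : hg = gh\}$ satisfies $$|C(g)| \;\ge\; \frac{q^n\,(1-1/q)}{e\,\bigl(1+\log_q(n+1)\bigr)},$$ where $e$ is the base of the natural logarithm and $\log_q$ is the logarithm to base $q$. Equivalently, the smallest centralizer size of an element of $GL(n,q)$ is at least the right-hand side. -/

import Mathlib

/-- Every quotient of a principal ideal domain by a nonzero ideal is self-injective. -/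
theorem Module.Baer.self_of_surjective_of_isPrincipalIdealRing {R A : Type*} [CommRing R]
    [IsDomain R] [IsPrincipalIdealRing R] [CommRing A] (f : R →+* A)
    (hf : Function.Surjective f) (hker : RingHom.ker f ≠ ⊥) : Module.Baer A A := by
  intro I g
  obtain ⟨m, hm⟩ := IsPrincipalIdealRing.principal (RingHom.ker f)
  have hm0 : m ≠ 0 := by rintro rfl; exact hker (by simpa using hm)
  obtain ⟨d, hd⟩ := IsPrincipalIdealRing.principal (I.comap f)
  have hmem (x : R) : f x = 0 ↔ m ∣ x := by
    rw [← RingHom.mem_ker, hm, Ideal.submodule_span_eq, Ideal.mem_span_singleton]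
  have hI (x : R) : f x ∈ I ↔ d ∣ x := by
    rw [← Ideal.mem_comap, hd, Ideal.submodule_span_eq, Ideal.mem_span_singleton]
  have hdI : f d ∈ I := (hI d).2 dvd_rfl
  obtain ⟨b, rfl⟩ : d ∣ m := (hI m).1 (by rw [(hmem m).2 dvd_rfl]; exact I.zero_mem)
  obtain ⟨y, hy⟩ := hf (g ⟨f d, hdI⟩)
  have hby : f (b * y) = 0 := by
    rw [map_mul, hy, ← smul_eq_mul, ← map_smul]
    convert map_zero g
    ext
    change f b * f d = 0
    rw [mul_comm, ← map_mul]
    exact (hmem _).2 dvd_rfl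
  obtain ⟨z, hz⟩ := (hmem _).1 hby
  have hyz : y = d * z := by
    refine mul_left_cancel₀ (right_ne_zero_of_mul hm0) ?_
    rw [hz]; ring
  refine ⟨LinearMap.mulRight A (f z), fun x hx ↦ ?_⟩
  obtain ⟨x, rfl⟩ := hf x
  obtain ⟨c, rfl⟩ := (hI x).1 hx
  have : (⟨f (d * c), hx⟩ : I) = f c • ⟨f d, hdI⟩ := by
    ext; simp [mul_comm]
  rw [this, map_smul, ← hy, hyz]
  simp only [LinearMap.mulRight_apply, smul_eq_mul, map_mul]
  ring

/-- If a finite module `M` over `A` has a free direct summand of rank one, then it has at least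
`|Aˣ| * |M| / |A|` automorphisms. -/
theorem card_units_mul_card_le_card_linearEquiv {A M : Type*} [CommRing A] [AddCommGroup M]
    [Module A M] [Finite M] (i : A →ₗ[A] M) (p : M →ₗ[A] A) (hpi : ∀ a, p (i a) = a) :
    Nat.card Aˣ * Nat.card M ≤ Nat.card A * Nat.card (M ≃ₗ[A] M) := by
  have hM : Nat.card M = Nat.card A * Nat.card (LinearMap.ker p) := by
    rw [← Nat.card_prod]
    refine Nat.card_congr
      { toFun := fun x ↦ (p x, ⟨x - i (p x), by simp [hpi]⟩)
        invFun := fun y ↦ i y.1 + y.2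
        left_inv := fun x ↦ by simp
        right_inv := ?_ }
    rintro ⟨a, w, hw⟩
    rw [LinearMap.mem_ker] at hw
    simp [hpi, hw]
  let φ (y : Aˣ × LinearMap.ker p) : M →ₗ[A] M :=
    (y.1 : A) • LinearMap.id + p.smulRight (y.2 : M)
  have hφ (y) : Function.Bijective (φ y) := by
    rw [← Finite.injective_iff_bijective]
    refine (injective_iff_map_eq_zero _).2 fun x hx ↦ ?_
    obtain ⟨u, w, hw⟩ := y
    rw [LinearMap.mem_ker] at hw
    simp only [φ, LinearMap.add_apply, LinearMap.smul_apply, LinearMap.id_coe, id_eq,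
      LinearMap.smulRight_apply] at hx
    have hpx : p x = 0 := by
      have := congrArg p hx
      simpa [hw] using this
    rw [hpx, zero_smul, add_zero] at hx
    have := congrArg (((u⁻¹ : Aˣ) : A) • ·) hx
    simpa [smul_smul] using this
  have hle : Nat.card (Aˣ × LinearMap.ker p) ≤ Nat.card (M ≃ₗ[A] M) := by
    have : Finite (M ≃ₗ[A] M) := DFunLike.finite _
    refine Nat.card_le_card_of_injective (fun y ↦ LinearEquiv.ofBijective (φ y) (hφ y)) ?_
    rintro ⟨u, w, hw⟩ ⟨u', w', hw'⟩ h
    rw [LinearMap.mem_ker] at hw hw'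
    have h1 := LinearEquiv.congr_fun h (i 1)
    simp only [φ, LinearEquiv.ofBijective_apply, LinearMap.add_apply, LinearMap.smul_apply,
      LinearMap.id_coe, id_eq, LinearMap.smulRight_apply, hpi, one_smul] at h1
    have h2 := congrArg p h1
    simp only [map_add, map_smul, hpi, hw, hw', smul_eq_mul, mul_one, add_zero] at h2
    rw [h2] at h1
    ext
    · exact h2
    · exact add_left_cancel h1
  rw [hM, mul_left_comm, ← Nat.card_prod]
  exact Nat.mul_le_mul_left _ hle

/-- A lower bound for the number of units of a finite commutative ring. -/
theorem card_mul_prod_le_card_units {A : Type*} [CommRing A] [Finite A]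
    [Fintype (MaximalSpectrum A)] :
    (Nat.card A : ℝ) * ∏ P : MaximalSpectrum A, (1 - 1 / (Nat.card (A ⧸ P.asIdeal) : ℝ)) ≤
      Nat.card Aˣ := by
  classical
  have hfinq (P : MaximalSpectrum A) : Finite (A ⧸ P.asIdeal) :=
    Finite.of_surjective _ Ideal.Quotient.mk_surjective
  let f : A →+* ∀ P : MaximalSpectrum A, A ⧸ P.asIdeal :=
    RingHom.pi fun P ↦ Ideal.Quotient.mk P.asIdeal
  have hf : Function.Surjective f := fun x ↦ by
    obtain ⟨r, hr⟩ := Ideal.pi_quotient_surjective (I := MaximalSpectrum.asIdeal)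
      (fun P Q h ↦ P.isCoprime_of_ne h) x
    exact ⟨r, funext hr⟩
  let s := Function.surjInv hf
  have hs (y) : f (s y) = y := Function.surjInv_eq hf y
  have hA : Nat.card A = Nat.card (∀ P : MaximalSpectrum A, A ⧸ P.asIdeal) *
      Nat.card (RingHom.ker f) := by
    rw [← Nat.card_prod]
    refine Nat.card_congr
      { toFun := fun x ↦ (f x, ⟨x - s (f x), by simp [RingHom.mem_ker, hs]⟩)
        invFun := fun y ↦ s y.1 + y.2
        left_inv := fun x ↦ by simp
        right_inv := ?_ }
    rintro ⟨a, w, hw⟩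
    rw [RingHom.mem_ker] at hw
    simp [hs, hw]
  have hunit (y : ∀ P : MaximalSpectrum A, {x : A ⧸ P.asIdeal // x ≠ 0}) (w : RingHom.ker f) :
      IsUnit (s (fun P ↦ (y P : A ⧸ P.asIdeal)) + w) := by
    by_contra h
    obtain ⟨P, hP, hmem⟩ := exists_max_ideal_of_mem_nonunits h
    apply (y ⟨P, hP⟩).2
    have h1 : f (s (fun P ↦ (y P : A ⧸ P.asIdeal)) + w) = fun P ↦ (y P : A ⧸ P.asIdeal) := by
      rw [map_add, hs, RingHom.mem_ker.1 w.2, add_zero]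
    rw [← congrFun h1 ⟨P, hP⟩]
    exact Ideal.Quotient.eq_zero_iff_mem.2 hmem
  have hU : Nat.card (∀ P : MaximalSpectrum A, {x : A ⧸ P.asIdeal // x ≠ 0}) *
      Nat.card (RingHom.ker f) ≤ Nat.card Aˣ := by
    rw [← Nat.card_prod]
    refine Nat.card_le_card_of_injective (fun y ↦ (hunit y.1 y.2).unit) ?_
    rintro ⟨y, w⟩ ⟨y', w'⟩ h
    have h0 : s (fun P ↦ (y P : A ⧸ P.asIdeal)) + w = s (fun P ↦ (y' P : A ⧸ P.asIdeal)) + w' :=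
      congrArg Units.val h
    have h1 := congrArg f h0
    rw [map_add, map_add, hs, hs, RingHom.mem_ker.1 w.2, RingHom.mem_ker.1 w'.2, add_zero,
      add_zero] at h1
    have h2 : y = y' := funext fun P ↦ Subtype.ext (congrFun h1 P)
    subst h2
    exact Prod.ext rfl (Subtype.ext (add_left_cancel h0))
  have hcard (P : MaximalSpectrum A) :
      (Nat.card {x : A ⧸ P.asIdeal // x ≠ 0} : ℝ) = Nat.card (A ⧸ P.asIdeal) - 1 := by
    have := Fintype.ofFinite (A ⧸ P.asIdeal)
    rw [Nat.card_eq_fintype_card, Nat.card_eq_fintype_card, Fintype.card_subtype_compl,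
      Fintype.card_subtype_eq, Nat.cast_sub Fintype.card_pos, Nat.cast_one]
  refine le_trans (le_of_eq ?_) (Nat.cast_le.2 hU)
  rw [hA, Nat.card_pi, Nat.card_pi]
  push_cast
  rw [mul_right_comm, ← Finset.prod_mul_distrib]
  congr 1
  refine Finset.prod_congr rfl fun P _ ↦ ?_
  have : (Nat.card (A ⧸ P.asIdeal) : ℝ) ≠ 0 := Nat.cast_ne_zero.2 Nat.card_pos.ne'
  rw [hcard]
  field_simp

/-- In a finite algebra generated by one unit over a finite field with `q` elements, at most
`(q ^ d - 1) / d` maximal ideals have residue degree `d`. -/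
theorem mul_card_maximalSpectrum_lt_pow {F A : Type*} [Field F] [Finite F] [CommRing A]
    [Finite A] [Algebra F A] [Fintype (MaximalSpectrum A)] {t : A} (ht : IsUnit t)
    (hgen : Algebra.adjoin F {t} = ⊤) (d : ℕ) :
    d * (Finset.univ.filter fun P : MaximalSpectrum A ↦
      Module.finrank F (A ⧸ P.asIdeal) = d).card < Nat.card F ^ d := by
  classical
  rcases Finset.eq_empty_or_nonempty (Finset.univ.filter fun P : MaximalSpectrum A ↦
      Module.finrank F (A ⧸ P.asIdeal) = d) with h | ⟨Q, hQ⟩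
  · rw [h, Finset.card_empty, mul_zero]
    exact pow_pos Nat.card_pos _
  replace hQ := (Finset.mem_filter.1 hQ).2
  have hfinq (P : MaximalSpectrum A) : Finite (A ⧸ P.asIdeal) :=
    Finite.of_surjective _ Ideal.Quotient.mk_surjective
  let _ (P : MaximalSpectrum A) : Field (A ⧸ P.asIdeal) := Ideal.Quotient.field P.asIdeal
  let L := A ⧸ Q.asIdeal
  have hfinL : Finite L := hfinq Q
  let S := {P : MaximalSpectrum A // Module.finrank F (A ⧸ P.asIdeal) = d}
  have hcount : Nat.card (Σ P : S, (A ⧸ P.1.asIdeal) →ₐ[F] L) =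
      d * (Finset.univ.filter fun P : MaximalSpectrum A ↦
        Module.finrank F (A ⧸ P.asIdeal) = d).card := by
    have hfin (P : S) : Finite ((A ⧸ P.1.asIdeal) →ₐ[F] L) := DFunLike.finite _
    rw [Nat.card_sigma, Finset.sum_congr rfl (g := fun _ ↦ d) fun P _ ↦ ?_]
    · rw [Finset.sum_const, smul_eq_mul, mul_comm, Finset.card_univ, Fintype.card_subtype]
    · rw [FiniteField.natCard_algHom_of_finrank_dvd, P.2]
      rw [P.2, hQ]
  have hL : Nat.card L = Nat.card F ^ d := by
    rw [Module.natCard_eq_pow_finrank (K := F), hQ]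
  let ev (x : Σ P : S, (A ⧸ P.1.asIdeal) →ₐ[F] L) : A →ₐ[F] L :=
    x.2.comp (Ideal.Quotient.mkₐ F x.1.1.asIdeal)
  have hinj : Function.Injective fun x ↦ ev x t := by
    rintro ⟨⟨P, hP⟩, σ⟩ ⟨⟨P', hP'⟩, σ'⟩ h
    have h1 := AlgHom.ext_of_adjoin_eq_top hgen
      (φ₁ := ev ⟨⟨P, hP⟩, σ⟩) (φ₂ := ev ⟨⟨P', hP'⟩, σ'⟩) (by simpa using h)
    have hPP : P = P' := by
      ext a
      have := congrArg (· = 0) (AlgHom.congr_fun h1 a)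
      simpa [ev, Ideal.Quotient.eq_zero_iff_mem] using this
    subst hPP
    congr 1
    ext x
    obtain ⟨a, rfl⟩ := Ideal.Quotient.mk_surjective x
    exact AlgHom.congr_fun h1 a
  rw [← hcount, ← hL]
  refine lt_of_not_ge fun hle ↦ ?_
  have hfin : Finite (Σ P : S, (A ⧸ P.1.asIdeal) →ₐ[F] L) := Finite.of_injective _ hinj
  have hbij := (Nat.bijective_iff_injective_and_card _).2
    ⟨hinj, le_antisymm (Nat.card_le_card_of_injective _ hinj) hle⟩
  obtain ⟨x, hx⟩ := hbij.2 0
  exact (ht.map (ev x)).ne_zero hx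

/-- The residue degrees of a finite algebra sum up to at most its dimension. -/
theorem sum_finrank_quotient_le {F A : Type*} [Field F] [CommRing A] [Finite A] [Algebra F A]
    [Module.Finite F A] [Fintype (MaximalSpectrum A)] :
    ∑ P : MaximalSpectrum A, Module.finrank F (A ⧸ P.asIdeal) ≤ Module.finrank F A := by
  let f : A →ₗ[F] ∀ P : MaximalSpectrum A, A ⧸ P.asIdeal :=
    LinearMap.pi fun P ↦ (Ideal.Quotient.mkₐ F P.asIdeal).toLinearMap
  have hf : Function.Surjective f := fun x ↦ by
    obtain ⟨r, hr⟩ := Ideal.pi_quotient_surjective (I := MaximalSpectrum.asIdeal)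
      (fun P Q h ↦ P.isCoprime_of_ne h) x
    exact ⟨r, funext hr⟩
  rw [← Module.finrank_pi_fintype]
  exact LinearMap.finrank_le_finrank_of_surjective hf

theorem exp_neg_inv_sub_one_le {x : ℝ} (hx : 1 < x) :
    Real.exp (-(1 / (x - 1))) ≤ 1 - 1 / x := by
  have h1 : 0 < x - 1 := sub_pos.2 hx
  have h2 : 0 < x := by linarith
  rw [Real.exp_neg, inv_le_comm₀ (Real.exp_pos _) (by rw [sub_pos, div_lt_one h2]; exact hx)]
  refine le_trans (le_of_eq ?_) (Real.add_one_le_exp _)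
  have : x - 1 ≠ 0 := h1.ne'
  field_simp
  ring

/-- A family of degrees with total at most `n`, in which each degree `k` occurs at most
`(q ^ k - 1) / k` times, satisfies `∑ 1 / (q ^ d - 1) ≤ 1 + log (1 + ⌊log_q (n + 1)⌋)`. -/
theorem sum_inv_pow_sub_one_le {ι : Type*} [Fintype ι] {q n : ℕ} (hq : 2 ≤ q) (d : ι → ℕ)
    (hd : ∀ i, 1 ≤ d i) (hn : ∑ i, d i ≤ n)
    (hc : ∀ k, k * (Finset.univ.filter fun i ↦ d i = k).card < q ^ k) :
    ∑ i, 1 / ((q : ℝ) ^ d i - 1) ≤ 1 + Real.log (Nat.log q (n + 1) + 1 : ℕ) := by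
  set D := Nat.log q (n + 1) with hD
  have hq1 : (1 : ℝ) < q := by exact_mod_cast hq
  have hpos (k : ℕ) (hk : 1 ≤ k) : 0 < (q : ℝ) ^ k - 1 :=
    sub_pos.2 (one_lt_pow₀ hq1 (by omega))
  have hsmall : ∑ i ∈ Finset.univ.filter (fun i ↦ d i ≤ D), 1 / ((q : ℝ) ^ d i - 1) ≤
      ∑ k ∈ Finset.Icc 1 D, (k : ℝ)⁻¹ := by
    rw [← Finset.sum_fiberwise_of_maps_to (t := Finset.Icc 1 D) (g := d)
      (fun i hi ↦ Finset.mem_Icc.2 ⟨hd i, (Finset.mem_filter.1 hi).2⟩)]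
    refine Finset.sum_le_sum fun k hk ↦ ?_
    obtain ⟨hk1, hkD⟩ := Finset.mem_Icc.1 hk
    rw [Finset.sum_congr rfl (g := fun _ ↦ 1 / ((q : ℝ) ^ k - 1)) fun i hi ↦ by
      rw [(Finset.mem_filter.1 hi).2], Finset.sum_const, nsmul_eq_mul]
    have hk0 : (0 : ℝ) < k := by exact_mod_cast hk1
    rw [mul_one_div, div_le_iff₀ (hpos k hk1), inv_mul_eq_div, le_div_iff₀ hk0, le_sub_iff_add_le,
      mul_comm]
    have hsub : (Finset.filter (fun i ↦ d i = k) (Finset.univ.filter fun i ↦ d i ≤ D)).card ≤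
        (Finset.univ.filter fun i ↦ d i = k).card :=
      Finset.card_le_card (Finset.filter_subset_filter _ (Finset.subset_univ _))
    exact_mod_cast (Nat.mul_le_mul_left k hsub).trans_lt (hc k)
  have hlarge : ∑ i ∈ Finset.univ.filter (fun i ↦ ¬ d i ≤ D), 1 / ((q : ℝ) ^ d i - 1) ≤
      ((D + 1 : ℕ) : ℝ)⁻¹ := by
    set w : ℝ := 1 / ((D + 1 : ℕ) * ((q : ℝ) ^ (D + 1) - 1)) with hw
    have hD1 : (0 : ℝ) < (D + 1 : ℕ) := by positivity
    have hP := hpos (D + 1) (by omega)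
    have hterm (i) (hi : i ∈ Finset.univ.filter (fun i ↦ ¬ d i ≤ D)) :
        1 / ((q : ℝ) ^ d i - 1) ≤ d i * w := by
      have hi' : D + 1 ≤ d i := by
        have := (Finset.mem_filter.1 hi).2
        omega
      have h1 : (q : ℝ) ^ (D + 1) - 1 ≤ (q : ℝ) ^ d i - 1 :=
        sub_le_sub_right (pow_le_pow_right₀ hq1.le hi') 1
      have h2 : ((D + 1 : ℕ) : ℝ) ≤ d i := by exact_mod_cast hi'
      rw [hw, mul_one_div, div_le_div_iff₀ (hP.trans_le h1) (by positivity), one_mul]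
      exact mul_le_mul h2 h1 hP.le (by positivity)
    have hw0 : 0 ≤ w := by positivity
    have hnlt : (n : ℝ) + 1 ≤ (q : ℝ) ^ (D + 1) - 1 := by
      have : n + 1 < q ^ (D + 1) := Nat.lt_pow_succ_log_self (by omega) _
      rw [le_sub_iff_add_le]
      exact_mod_cast this
    calc _ ≤ ∑ i ∈ Finset.univ.filter (fun i ↦ ¬ d i ≤ D), d i * w := Finset.sum_le_sum hterm
      _ ≤ ∑ i, d i * w :=
        Finset.sum_le_sum_of_subset_of_nonneg (Finset.subset_univ _) fun i _ _ ↦ by positivity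
      _ = (∑ i, d i : ℕ) * w := by rw [Nat.cast_sum, Finset.sum_mul]
      _ ≤ ((q : ℝ) ^ (D + 1) - 1) * w := by
        refine mul_le_mul_of_nonneg_right ?_ hw0
        have : ((∑ i, d i : ℕ) : ℝ) ≤ n := by exact_mod_cast hn
        linarith
      _ = _ := by
        have := hP.ne'
        rw [hw]
        field_simp
  rw [← Finset.sum_filter_add_sum_filter_not Finset.univ (fun i ↦ d i ≤ D)]
  refine (add_le_add hsmall hlarge).trans ?_
  rw [← Finset.sum_Icc_succ_top (by omega) fun k : ℕ ↦ (k : ℝ)⁻¹]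
  have := harmonic_le_one_add_log (D + 1)
  simpa only [harmonic_eq_sum_Icc, Rat.cast_sum, Rat.cast_inv, Rat.cast_natCast] using this

theorem inv_le_prod_one_sub_inv_pow {ι : Type*} [Fintype ι] {q n : ℕ} (hq : 2 ≤ q) (d : ι → ℕ)
    (hd : ∀ i, 1 ≤ d i) (hn : ∑ i, d i ≤ n)
    (hc : ∀ k, k * (Finset.univ.filter fun i ↦ d i = k).card < q ^ k) :
    1 / (Real.exp 1 * (1 + Real.logb q (n + 1))) ≤ ∏ i, (1 - 1 / (q : ℝ) ^ d i) := by
  have hq1 : (1 : ℝ) < q := by exact_mod_cast hq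
  have hlog : ((Nat.log q (n + 1) + 1 : ℕ) : ℝ) ≤ 1 + Real.logb q (n + 1) := by
    rw [Nat.cast_add, Nat.cast_one, add_comm]
    refine add_le_add_right ?_ 1
    have := Real.natLog_le_logb (n + 1) q
    exact_mod_cast this
  have hD : (0 : ℝ) < (Nat.log q (n + 1) + 1 : ℕ) := by positivity
  calc 1 / (Real.exp 1 * (1 + Real.logb q (n + 1)))
      ≤ 1 / (Real.exp 1 * (Nat.log q (n + 1) + 1 : ℕ)) := by gcongr
    _ = Real.exp (-(1 + Real.log (Nat.log q (n + 1) + 1 : ℕ))) := by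
      rw [Real.exp_neg, Real.exp_add, Real.exp_log hD, one_div]
    _ ≤ Real.exp (-∑ i, 1 / ((q : ℝ) ^ d i - 1)) :=
      Real.exp_le_exp.2 (neg_le_neg (sum_inv_pow_sub_one_le hq d hd hn hc))
    _ = ∏ i, Real.exp (-(1 / ((q : ℝ) ^ d i - 1))) := by
      rw [← Real.exp_sum, Finset.sum_neg_distrib]
    _ ≤ _ := Finset.prod_le_prod (fun _ _ ↦ (Real.exp_pos _).le) fun i _ ↦
      exp_neg_inv_sub_one_le (one_lt_pow₀ hq1 (by have := hd i; omega))

/-- A bound on the number of automorphisms of a finite module over `F[T]`, for an invertible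
endomorphism `T` of a vector space over a finite field. -/
theorem le_card_linearEquiv_adjoin {F V : Type*} [Field F] [Finite F] [AddCommGroup V]
    [Module F V] [Module.Finite F V] (T : Module.End F V) (hT : IsUnit T) :
    (Nat.card F : ℝ) ^ Module.finrank F V /
        (Real.exp 1 * (1 + Real.logb (Nat.card F) (Module.finrank F V + 1))) ≤
      Nat.card (V ≃ₗ[Algebra.adjoin F {T}] V) := by
  have hV : Finite V := Module.finite_of_finite F
  have hE : Finite (Module.End F V) := Module.finite_of_finite F
  let t : Algebra.adjoin F {T} := ⟨T, Algebra.self_mem_adjoin_singleton F T⟩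
  have hgen : Algebra.adjoin F {t} = ⊤ := by
    rw [← Algebra.adjoin_adjoin_coe_preimage]
    congr 1
    ext a
    exact Subtype.ext_iff
  let f : Polynomial F →ₐ[F] Algebra.adjoin F {T} := Polynomial.aeval t
  have hf : Function.Surjective f := by
    rw [← AlgHom.range_eq_top, ← Algebra.adjoin_singleton_eq_range_aeval, hgen]
  have hfT (p : Polynomial F) (x : V) : f p • x = Polynomial.aeval T p x := by
    have : ((f p : Algebra.adjoin F {T}) : Module.End F V) = Polynomial.aeval T p :=
      (Polynomial.aeval_algHom_apply (Algebra.adjoin F {T}).val t p).symm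
    rw [← this]
    rfl
  have hker : RingHom.ker f.toRingHom ≠ ⊥ := fun h ↦
    have := Finite.of_injective _ ((RingHom.injective_iff_ker_eq_bot _).2 h)
    not_finite (Polynomial F)
  have ht : IsUnit t := by
    rw [isUnit_iff_mem_nonZeroDivisors_of_finite, mem_nonZeroDivisors_iff_right]
    intro a ha
    exact Subtype.ext (hT.mul_left_eq_zero.1 (congrArg Subtype.val ha))
  obtain ⟨v, hv⟩ : ∃ v : V, ∀ a : Algebra.adjoin F {T}, a • v = 0 → a = 0 := by
    obtain ⟨x, hx⟩ := Module.exists_ker_toSpanSingleton_eq_annihilator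
      (R := Polynomial F) (M := Module.AEval' T)
    refine ⟨(Module.AEval'.of T).symm x, fun a ha ↦ ?_⟩
    obtain ⟨p, rfl⟩ := hf a
    have hp : p ∈ Module.annihilator (Polynomial F) (Module.AEval' T) := by
      rw [← hx, LinearMap.mem_ker, LinearMap.toSpanSingleton_apply]
      apply (Module.AEval'.of T).symm.injective
      rw [map_zero, ← ha, hfT]
      exact Module.AEval.of_symm_smul T p x
    rw [Module.mem_annihilator] at hp
    ext y
    have := congrArg (Module.AEval'.of T).symm (hp (Module.AEval'.of T y))
    rw [map_zero] at this
    refine Eq.trans ?_ this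
    exact (hfT p y).trans (Module.AEval.of_symm_smul T p (Module.AEval'.of T y)).symm
  let i : Algebra.adjoin F {T} →ₗ[Algebra.adjoin F {T}] V := LinearMap.toSpanSingleton _ _ v
  have hi : Function.Injective i := (injective_iff_map_eq_zero i).2 hv
  obtain ⟨p, hp⟩ := (Module.Baer.self_of_surjective_of_isPrincipalIdealRing f.toRingHom hf
    hker).extension_property i hi LinearMap.id
  have hcard := card_units_mul_card_le_card_linearEquiv i p (LinearMap.congr_fun hp)
  have := Fintype.ofFinite (MaximalSpectrum (Algebra.adjoin F {T}))
  have hq : 2 ≤ Nat.card F := Finite.one_lt_card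
  have hdim : Module.finrank F (Algebra.adjoin F {T}) ≤ Module.finrank F V :=
    LinearMap.finrank_le_finrank_of_injective (f := i.restrictScalars F) hi
  have hpos (P : MaximalSpectrum (Algebra.adjoin F {T})) :
      1 ≤ Module.finrank F (Algebra.adjoin F {T} ⧸ P.asIdeal) := by
    have : Nontrivial (Algebra.adjoin F {T} ⧸ P.asIdeal) :=
      Ideal.Quotient.nontrivial_iff.2 P.isMaximal.ne_top
    exact Module.finrank_pos
  have hprod := inv_le_prod_one_sub_inv_pow hq
    (fun P : MaximalSpectrum (Algebra.adjoin F {T}) ↦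
      Module.finrank F (Algebra.adjoin F {T} ⧸ P.asIdeal))
    (hpos) (sum_finrank_quotient_le.trans hdim)
    (mul_card_maximalSpectrum_lt_pow ht hgen)
  have hunits := card_mul_prod_le_card_units (A := Algebra.adjoin F {T})
  have hA : (0 : ℝ) < Nat.card (Algebra.adjoin F {T}) := Nat.cast_pos.2 Nat.card_pos
  simp only [Module.natCard_eq_pow_finrank (K := F) (V := Algebra.adjoin F {T} ⧸ _),
    Nat.cast_pow] at hunits
  have hcard' : (Nat.card (Algebra.adjoin F {T})ˣ : ℝ) * (Nat.card F : ℝ) ^ Module.finrank F V ≤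
      Nat.card (Algebra.adjoin F {T}) * Nat.card (V ≃ₗ[Algebra.adjoin F {T}] V) := by
    rw [Module.natCard_eq_pow_finrank (K := F) (V := V)] at hcard
    exact_mod_cast hcard
  refine le_of_mul_le_mul_left (le_trans ?_ hcard') hA
  rw [← mul_one_div, mul_left_comm, mul_comm]
  exact mul_le_mul_of_nonneg_right ((mul_le_mul_of_nonneg_left hprod hA.le).trans hunits)
    (by positivity)

theorem card_linearEquiv_adjoin_le_card_centralizer {F ι : Type*} [Field F] [Finite F]
    [Fintype ι] [DecidableEq ι] (g : Matrix.GeneralLinearGroup ι F) :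
    Nat.card ((ι → F) ≃ₗ[Algebra.adjoin F {Matrix.toLin' (g : Matrix ι ι F)}] (ι → F)) ≤
      Nat.card (Subgroup.centralizer ({g} : Set (Matrix.GeneralLinearGroup ι F))) := by
  set T := Matrix.toLin' (g : Matrix ι ι F) with hT
  let φ (e : (ι → F) ≃ₗ[Algebra.adjoin F {T}] (ι → F)) : Matrix.GeneralLinearGroup ι F :=
    (LinearMap.GeneralLinearGroup.generalLinearEquiv F (ι → F)).symm (e.restrictScalars F) |>
      Matrix.GeneralLinearGroup.toLin.symm
  have hφ (e) : ((φ e : Matrix.GeneralLinearGroup ι F) : Matrix ι ι F) =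
      LinearMap.toMatrix' (e.restrictScalars F).toLinearMap := rfl
  refine Nat.card_le_card_of_injective (fun e ↦ ⟨φ e, ?_⟩) fun e e' h ↦ ?_
  · rw [Subgroup.mem_centralizer_singleton_iff]
    ext1
    apply Matrix.toLin'.injective
    rw [Units.val_mul, Units.val_mul, hφ, Matrix.toLin'_mul, Matrix.toLin'_mul,
      Matrix.toLin'_toMatrix', ← hT]
    refine LinearMap.ext fun x ↦ ?_
    exact e.map_smul ⟨T, Algebra.self_mem_adjoin_singleton F T⟩ x
  · have h1 := congrArg (fun a : Subgroup.centralizer ({g} : Set _) ↦ (a.1 : Matrix ι ι F)) h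
    simp only [hφ] at h1
    have h2 := LinearMap.toMatrix'.injective h1
    exact LinearEquiv.ext fun x ↦ LinearMap.congr_fun h2 x

theorem mainTheorem9 {F : Type*} [Field F] [Finite F] (q : ℕ) (hq : Nat.card F = q)
    (n : ℕ) (g : Matrix.GeneralLinearGroup (Fin n) F) :
    (q : ℝ) ^ n * (1 - 1 / (q : ℝ)) / (Real.exp 1 * (1 + Real.logb (q : ℝ) ((n : ℝ) + 1))) ≤
      (Nat.card (Subgroup.centralizer ({g} : Set (Matrix.GeneralLinearGroup (Fin n) F))) : ℝ) := by
  subst hq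
  have hT : IsUnit (Matrix.toLin' (g : Matrix (Fin n) (Fin n) F)) :=
    g.isUnit.map (Matrix.toLinAlgEquiv' (R := F) (n := Fin n))
  have h := (le_card_linearEquiv_adjoin _ hT).trans
    (Nat.cast_le.2 (card_linearEquiv_adjoin_le_card_centralizer g))
  rw [Module.finrank_fin_fun] at h
  refine le_trans ?_ h
  have hq1 : (1 : ℝ) < Nat.card F := by exact_mod_cast Finite.one_lt_card (α := F)
  have hlog : 0 ≤ Real.logb (Nat.card F) ((n : ℝ) + 1) :=
    Real.logb_nonneg hq1 (by linarith [n.cast_nonneg (α := ℝ)])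
  refine div_le_div_of_nonneg_right (mul_le_of_le_one_right (by positivity) ?_) (by positivity)
  rw [sub_le_self_iff]
  positivity
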